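/- Let $k$ be a field, let $\mathbb{P}^3=\mathbb{P}^3_k$ and write $\mathcal{O}(n)=\mathcal{O}_{\mathbb{P}^3}(n)$. A monad is a complex of vector bundles $\mathcal{C}\xrightarrow{\beta}\mathcal{B}\xrightarrow{\alpha}\mathcal{A}$ on $\mathbb{P}^3$, with $\alpha\circ\beta=0$, in which $\beta$ is injective and locally left invertible and $\alpha$ is surjective. It is minimal if no nonzero direct summand of $\mathcal{A}$ is the image under $\alpha$ of a line subbundle of $\mathcal{B}$, and $\beta$ maps no nonzero direct summand of $\mathcal{C}$ onto a direct summand of $\mathcal{B}$. Proposition 6.3. There are no minimal monads of type (P15), that is, no minimal monads of the form $$\mathcal{O}(-2)\oplus\mathcal{O}(-4)\xrightarrow{\ \beta\ }3\cdot\mathcal{O}(1)\oplus3\cdot\mathcal{O}(-2)\xrightarrow{\ \alpha\ }\mathcal{O}(1)\oplus\mathcal{O}(3).$$ -/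

import Mathlib

universe u

open CategoryTheory AlgebraicGeometry TopologicalSpace Opposite Limits

noncomputable section

namespace ProjTwist

variable {A σ : Type u} [CommRing A] [SetLike σ A] [AddSubgroupClass σ A]
variable (𝒜 : ℕ → σ) [GradedRing 𝒜]

/-- The homogeneous prime ideal of a point of `Proj 𝒜`. -/
def pt (x : Proj 𝒜) : ProjectiveSpectrum 𝒜 := x

/-- The localization `A_𝔭` of `A` at the homogeneous prime `𝔭` of a point of `Proj 𝒜`. -/
def LocAt (x : Proj 𝒜) : Type u :=
  Localization.AtPrime (pt 𝒜 x).asHomogeneousIdeal.toIdeal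

instance (x : Proj 𝒜) : CommRing (LocAt 𝒜 x) :=
  inferInstanceAs (CommRing (Localization.AtPrime (pt 𝒜 x).asHomogeneousIdeal.toIdeal))

instance (x : Proj 𝒜) : Algebra A (LocAt 𝒜 x) :=
  inferInstanceAs (Algebra A (Localization.AtPrime (pt 𝒜 x).asHomogeneousIdeal.toIdeal))

instance (x : Proj 𝒜) :
    IsLocalization.AtPrime (LocAt 𝒜 x) (pt 𝒜 x).asHomogeneousIdeal.toIdeal :=
  inferInstanceAs (IsLocalization.AtPrime
    (Localization.AtPrime (pt 𝒜 x).asHomogeneousIdeal.toIdeal) _)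

/-- A family `f x ∈ A_𝔭(x)`, for `x` in an open set `U`, is a fraction of degree `n` if it is
given on all of `U` by one fraction `r / s` with `r`, `s` homogeneous, `deg r - deg s = n`
and `s` without zeros on `U`. -/
def IsFraction (n : ℤ) {U : (Proj 𝒜).Opens}
    (f : ∀ x : U, LocAt 𝒜 x.1) : Prop :=
  ∃ (i j : ℕ) (r s : A), r ∈ 𝒜 i ∧ s ∈ 𝒜 j ∧ (i : ℤ) = j + n ∧
    ∀ x : U, s ∉ (pt 𝒜 x.1).asHomogeneousIdeal ∧
      algebraMap A (LocAt 𝒜 x.1) s * f x = algebraMap A (LocAt 𝒜 x.1) r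

/-- Being a fraction of degree `n` passes to smaller open sets. -/
def isFractionPrelocal (n : ℤ) :
    TopCat.PrelocalPredicate fun x : Proj 𝒜 => LocAt 𝒜 x where
  pred f := IsFraction 𝒜 n f
  res := by
    rintro V U i f ⟨a, b, r, s, hr, hs, hd, h⟩
    exact ⟨a, b, r, s, hr, hs, hd, fun x => h (i x)⟩

/-- Being locally a fraction of degree `n`. -/
def isLocallyFraction (n : ℤ) :
    TopCat.LocalPredicate fun x : Proj 𝒜 => LocAt 𝒜 x :=
  (isFractionPrelocal 𝒜 n).sheafify

/-- The value of a regular function on `Proj 𝒜` at a point, as an element of `A_𝔭`. -/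
def value {U : (Proj 𝒜).Opens} (r : Γ(Proj 𝒜, U)) (x : U) : LocAt 𝒜 x.1 :=
  (r.1 x).val

theorem value_add {U : (Proj 𝒜).Opens} (r s : Γ(Proj 𝒜, U)) (x : U) :
    value 𝒜 (r + s) x = value 𝒜 r x + value 𝒜 s x :=
  HomogeneousLocalization.val_add (r.1 x) (s.1 x)

theorem value_mul {U : (Proj 𝒜).Opens} (r s : Γ(Proj 𝒜, U)) (x : U) :
    value 𝒜 (r * s) x = value 𝒜 r x * value 𝒜 s x :=
  HomogeneousLocalization.val_mul (r.1 x) (s.1 x)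

theorem value_zero {U : (Proj 𝒜).Opens} (x : U) :
    value 𝒜 (0 : Γ(Proj 𝒜, U)) x = 0 :=
  HomogeneousLocalization.val_zero

theorem value_one {U : (Proj 𝒜).Opens} (x : U) :
    value 𝒜 (1 : Γ(Proj 𝒜, U)) x = 1 :=
  HomogeneousLocalization.val_one

/-- A regular function is locally a fraction of degree `0`. -/
theorem isLocallyFraction_value {U : (Proj 𝒜).Opens} (r : Γ(Proj 𝒜, U)) :
    (isLocallyFraction 𝒜 0).pred (U := U) (value 𝒜 r) := by
  intro x
  obtain ⟨V, hxV, i, n, a, b, hb, h⟩ := r.2 x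
  refine ⟨V, hxV, i, n, n, a.1, b.1, a.2, b.2, by simp, fun y => ⟨hb y, ?_⟩⟩
  have h1 : (r.1 (i y)).val = Localization.mk a.1 ⟨b.1, hb y⟩ := by
    have := congrArg HomogeneousLocalization.val (h y)
    exact this
  have h2 : algebraMap A _ b.1 * (r.1 (i y)).val = algebraMap A _ a.1 := by
    rw [h1, ← Localization.mk_one_eq_algebraMap, Localization.mk_mul,
      ← Localization.mk_one_eq_algebraMap, Localization.mk_eq_mk_iff, Localization.r_iff_exists]
    exact ⟨1, by simp⟩
  exact h2

theorem exists_homogeneous_notMem (x : Proj 𝒜) :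
    ∃ (f : A) (m : ℕ), f ∈ 𝒜 m ∧ 0 < m ∧ f ∉ (pt 𝒜 x).asHomogeneousIdeal := by
  classical
  by_contra! h
  refine (pt 𝒜 x).not_irrelevant_le fun z hz => ?_
  rw [← DirectSum.sum_support_decompose 𝒜 z]
  refine (pt 𝒜 x).asHomogeneousIdeal.toIdeal.sum_mem fun k hk => ?_
  by_cases hk0 : k = 0
  · have h0 : (DirectSum.decompose 𝒜 z 0 : A) = 0 := hz
    rw [hk0, h0]
    exact zero_mem _
  · exact h _ k (SetLike.coe_mem _) (Nat.pos_of_ne_zero hk0)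

/-- The sections of `𝒪(n)` over `U`, as a subgroup of all families of elements of the
localizations. -/
def sections (n : ℤ) (U : (Proj 𝒜).Opens) : AddSubgroup (∀ x : U, LocAt 𝒜 x.1) where
  carrier := {f | (isLocallyFraction 𝒜 n).pred f}
  zero_mem' := by
    intro x
    obtain ⟨f, m, hf, hm, hx⟩ := exists_homogeneous_notMem 𝒜 x.1
    refine ⟨U ⊓ ProjectiveSpectrum.basicOpen 𝒜 f, ⟨x.2, hx⟩, Opens.infLELeft _ _,
      m * n.natAbs + n.toNat - (-n).toNat, m * n.natAbs, 0, f ^ n.natAbs, zero_mem _,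
      ?_, ?_, fun y => ⟨fun h => y.2.2 ((pt 𝒜 y.1).isPrime.mem_of_pow_mem _ h), ?_⟩⟩
    · rw [mul_comm]
      exact SetLike.pow_mem_graded _ hf
    · have h1 : n.natAbs ≤ m * n.natAbs := Nat.le_mul_of_pos_left _ hm
      generalize m * n.natAbs = q at h1 ⊢
      lia
    · change algebraMap A (LocAt 𝒜 y.1) _ * 0 = algebraMap A (LocAt 𝒜 y.1) 0
      rw [mul_zero, map_zero]
  add_mem' := by
    intro f g hf hg x
    obtain ⟨V, hxV, i, a, b, r, s, hr, hs, hd, h⟩ := hf x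
    obtain ⟨V', hxV', i', a', b', r', s', hr', hs', hd', h'⟩ := hg x
    refine ⟨V ⊓ V', ⟨hxV, hxV'⟩, Opens.infLELeft _ _ ≫ i, a + b', b + b', r * s' + r' * s, s * s',
      ?_, SetLike.mul_mem_graded hs hs', by push_cast; lia, fun y => ⟨?_, ?_⟩⟩
    · have e : a' + b = a + b' := by lia
      exact add_mem (SetLike.mul_mem_graded hr hs') (e ▸ SetLike.mul_mem_graded hr' hs)
    · intro hm
      rcases (pt 𝒜 y.1).isPrime.mem_or_mem hm with hm | hm
      · exact (h ⟨y.1, y.2.1⟩).1 hm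
      · exact (h' ⟨y.1, y.2.2⟩).1 hm
    · have h1 := (h ⟨y.1, y.2.1⟩).2
      have h2 := (h' ⟨y.1, y.2.2⟩).2
      change algebraMap A (LocAt 𝒜 y.1) s * f (i ⟨y.1, y.2.1⟩) = _ at h1
      change algebraMap A (LocAt 𝒜 y.1) s' * g (i' ⟨y.1, y.2.2⟩) = _ at h2
      change algebraMap A (LocAt 𝒜 y.1) _ *
        (f (i ⟨y.1, y.2.1⟩) + g (i' ⟨y.1, y.2.2⟩)) = algebraMap A (LocAt 𝒜 y.1) _
      rw [map_add, map_mul, map_mul, map_mul]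
      linear_combination algebraMap A (LocAt 𝒜 y.1) s' * h1 + algebraMap A (LocAt 𝒜 y.1) s * h2
  neg_mem' := by
    intro f hf x
    obtain ⟨V, hxV, i, a, b, r, s, hr, hs, hd, h⟩ := hf x
    refine ⟨V, hxV, i, a, b, -r, s, neg_mem hr, hs, hd, fun y => ⟨(h y).1, ?_⟩⟩
    have h1 := (h y).2
    change algebraMap A (LocAt 𝒜 y.1) s * f (i y) = _ at h1
    change algebraMap A (LocAt 𝒜 y.1) s * (-f (i y)) = algebraMap A (LocAt 𝒜 y.1) (-r)
    rw [map_neg]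
    linear_combination -h1

theorem smul_mem (n : ℤ) {U : (Proj 𝒜).Opens} (r : Γ(Proj 𝒜, U)) {f : ∀ x : U, LocAt 𝒜 x.1}
    (hf : f ∈ sections 𝒜 n U) : (fun x => value 𝒜 r x * f x) ∈ sections 𝒜 n U := by
  intro x
  obtain ⟨V, hxV, i, a, b, p, s, hp, hs, hd, h⟩ := isLocallyFraction_value 𝒜 r x
  obtain ⟨V', hxV', i', a', b', p', s', hp', hs', hd', h'⟩ := hf x
  refine ⟨V ⊓ V', ⟨hxV, hxV'⟩, Opens.infLELeft _ _ ≫ i, a + a', b + b', p * p', s * s',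
    SetLike.mul_mem_graded hp hp', SetLike.mul_mem_graded hs hs', by push_cast; lia,
    fun y => ⟨?_, ?_⟩⟩
  · intro hm
    rcases (pt 𝒜 y.1).isPrime.mem_or_mem hm with hm | hm
    · exact (h ⟨y.1, y.2.1⟩).1 hm
    · exact (h' ⟨y.1, y.2.2⟩).1 hm
  · have h1 := (h ⟨y.1, y.2.1⟩).2
    have h2 := (h' ⟨y.1, y.2.2⟩).2
    change algebraMap A (LocAt 𝒜 y.1) s * value 𝒜 r (i ⟨y.1, y.2.1⟩) = _ at h1
    change algebraMap A (LocAt 𝒜 y.1) s' * f (i' ⟨y.1, y.2.2⟩) = _ at h2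
    change algebraMap A (LocAt 𝒜 y.1) _ *
      (value 𝒜 r (i ⟨y.1, y.2.1⟩) * f (i' ⟨y.1, y.2.2⟩)) = algebraMap A (LocAt 𝒜 y.1) _
    rw [map_mul, map_mul, ← h1, ← h2]
    ring

instance (n : ℤ) (U : (Proj 𝒜).Opens) : Module Γ(Proj 𝒜, U) (sections 𝒜 n U) where
  smul r f := ⟨fun x => value 𝒜 r x * f.1 x, smul_mem 𝒜 n r f.2⟩
  one_smul f := Subtype.ext <| funext fun x => by
    change value 𝒜 1 x * f.1 x = f.1 x
    rw [value_one, one_mul]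
  mul_smul r s f := Subtype.ext <| funext fun x => by
    change value 𝒜 (r * s) x * f.1 x = value 𝒜 r x * (value 𝒜 s x * f.1 x)
    rw [value_mul, mul_assoc]
  smul_zero r := Subtype.ext <| funext fun x => mul_zero (value 𝒜 r x)
  smul_add r f g := Subtype.ext <| funext fun x => mul_add (value 𝒜 r x) (f.1 x) (g.1 x)
  add_smul r s f := Subtype.ext <| funext fun x => by
    change value 𝒜 (r + s) x * f.1 x = value 𝒜 r x * f.1 x + value 𝒜 s x * f.1 x
    rw [value_add, add_mul]
  zero_smul f := Subtype.ext <| funext fun x => by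
    change value 𝒜 0 x * f.1 x = 0
    rw [value_zero, zero_mul]

/-- Restriction of sections of `𝒪(n)`. -/
def res (n : ℤ) {U V : (Proj 𝒜).Opens} (i : U ⟶ V) : sections 𝒜 n V →+ sections 𝒜 n U where
  toFun f := ⟨fun x => f.1 (i x), (isLocallyFraction 𝒜 n).res i f.1 f.2⟩
  map_zero' := rfl
  map_add' _ _ := rfl

/-- The presheaf of abelian groups underlying `𝒪(n)`. -/
def abPresheaf (n : ℤ) : TopCat.Presheaf Ab.{u} (Proj 𝒜) where
  obj U := AddCommGrpCat.of (sections 𝒜 n U.unop)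
  map i := AddCommGrpCat.ofHom (res 𝒜 n i.unop)

theorem abPresheaf_isSheaf (n : ℤ) : (abPresheaf 𝒜 n).IsSheaf :=
  (TopCat.Presheaf.isSheaf_iff_isSheaf_comp (forget Ab.{u}) _).2
    (TopCat.subsheafToTypes (isLocallyFraction 𝒜 n)).2

instance (n : ℤ) (U : (Proj 𝒜).Opensᵒᵖ) :
    Module ((Proj 𝒜).ringCatSheaf.obj.obj U) ((abPresheaf 𝒜 n).obj U) :=
  inferInstanceAs (Module Γ(Proj 𝒜, U.unop) (sections 𝒜 n U.unop))

/-- The twisting sheaf `𝒪(n)` on `Proj 𝒜`. -/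
def twist (n : ℤ) : (Proj 𝒜).Modules where
  val := PresheafOfModules.ofPresheaf (R := (Proj 𝒜).ringCatSheaf.obj) (abPresheaf 𝒜 n)
    (fun _ _ _ _ _ => rfl)
  isSheaf := abPresheaf_isSheaf 𝒜 n

end ProjTwist

namespace SheafMonad

/-- A morphism of sheaves of modules is surjective if every section of the target lifts locally. -/
def IsSurjective {X : Scheme.{u}} {F G : X.Modules} (φ : F ⟶ G) : Prop :=
  TopCat.Presheaf.IsLocallySurjective φ.mapPresheaf

/-- A morphism of sheaves of modules is locally left invertible if every point has an open
neighbourhood on which it has a left inverse. For vector bundles these are the inclusions of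
subbundles. -/
def IsLocallyLeftInvertible {X : Scheme.{u}} {F G : X.Modules} (φ : F ⟶ G) : Prop :=
  ∀ x : X, ∃ U : X.Opens, x ∈ U ∧ IsSplitMono ((Scheme.Modules.restrictFunctor U.ι).map φ)

/-- A sheaf of modules is a line bundle if every point has an open neighbourhood `U` with a
section `e` that is a basis of it over `U`: on each open `V ⊆ U`, `r ↦ r • e|_V` is bijective. -/
def IsLineBundle {X : Scheme.{u}} (L : X.Modules) : Prop :=
  ∀ x : X, ∃ U : X.Opens, x ∈ U ∧ ∃ e : Γ(L, U), ∀ (V : X.Opens) (i : V ⟶ U),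
    Function.Bijective fun r : Γ(X, V) => (r • L.presheaf.map i.op e : Γ(L, V))

/-- The image of `φ : F ⟶ G` is a nonzero direct summand of `G`: `φ` is a surjection onto some
`D ≠ 0` followed by the inclusion of `D` as a direct summand of `G`. -/
def ImageIsDirectSummand {X : Scheme.{u}} {F G : X.Modules} (φ : F ⟶ G) : Prop :=
  ∃ (D : X.Modules) (p : F ⟶ D) (i : D ⟶ G),
    ¬ IsZero D ∧ IsSurjective p ∧ IsSplitMono i ∧ p ≫ i = φ

end SheafMonad

/-- A monad `C ⟶ B ⟶ A`: a complex with `β` injective and locally left invertible and `α`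
surjective. -/
structure SheafMonad {X : Scheme.{u}} (C B A : X.Modules) where
  β : C ⟶ B
  α : B ⟶ A
  comp_eq_zero : β ≫ α = 0
  injective : Mono β
  locallyLeftInvertible : SheafMonad.IsLocallyLeftInvertible β
  surjective : SheafMonad.IsSurjective α

/-- A monad is minimal if no direct summand of `A` is the image of a line subbundle of `B` and no
direct summand of `C` goes onto a direct summand of `B` (direct summands being nonzero). -/
def SheafMonad.IsMinimal {X : Scheme.{u}} {C B A : X.Modules} (M : SheafMonad C B A) : Prop :=
  (¬ ∃ (L : X.Modules) (ι : L ⟶ B), SheafMonad.IsLineBundle L ∧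
    SheafMonad.IsLocallyLeftInvertible ι ∧ SheafMonad.ImageIsDirectSummand (ι ≫ M.α)) ∧
  (¬ ∃ (D : X.Modules) (i : D ⟶ C), ¬ IsZero D ∧ IsSplitMono i ∧
    SheafMonad.ImageIsDirectSummand (i ≫ M.β))

attribute [local instance] MvPolynomial.gradedAlgebra Abelian.hasFiniteBiproducts

/-- Projective 3-space over a field `k`. -/
abbrev P3 (k : Type u) [Field k] : Scheme.{u} :=
  Proj (MvPolynomial.homogeneousSubmodule (Fin 4) k)

/-- The line bundle `𝒪(n)` on projective 3-space. -/
abbrev P3.O (k : Type u) [Field k] (n : ℤ) : (P3 k).Modules :=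
  ProjTwist.twist (MvPolynomial.homogeneousSubmodule (Fin 4) k) n

/-- A Horrocks monad on projective 3-space with degrees `a` and `b`:
`⨁ᵢ 𝒪(-aᵢ-1) ⟶ ⨁ⱼ (𝒪(bⱼ) ⊕ 𝒪(-bⱼ-1)) ⟶ ⨁ᵢ 𝒪(aᵢ)`. -/
abbrev HorrocksMonad (k : Type u) [Field k] {s : ℕ} (a : Fin s → ℤ) (b : Fin (s + 1) → ℤ) :
    Type u :=
  SheafMonad (X := P3 k) (⨁ fun i => P3.O k (-a i - 1))
    (⨁ fun j => P3.O k (b j) ⊞ P3.O k (-b j - 1)) (⨁ fun i => P3.O k (a i))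

/-- Monads `𝒪(-2) ⊕ 𝒪(-4) ⟶ 𝒪(1)³ ⊕ 𝒪(-2)³ ⟶ 𝒪(1) ⊕ 𝒪(3)`: the degrees of the right-hand term
are `1, 3` and the nonnegative degrees of the middle term are `1, 1, 1`. -/
abbrev MonadP15 (k : Type u) [Field k] : Type u :=
  HorrocksMonad k ![1, 3] ![1, 1, 1]

end

/-!
Consider the component `B ⟶ 𝒪(1)` of `α`. On each of the three summands `𝒪(1)` of `B` it is an
endomorphism of `𝒪(1)`, that is, a constant. If one of these constants is not zero, then that
summand is a line subbundle which `α` embeds as a direct summand, against minimality. So they all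
vanish, and `𝒪(1)` must be covered by the three summands `𝒪(-2)` alone, on which `α` is given by
three cubic forms. By Krull's height theorem three forms in four variables have a common zero in
projective space, and there `α` is not surjective.

The proof needs the morphisms between twisting sheaves (`ProjTwist.exists_form`): a morphism
`𝒪(m) ⟶ 𝒪(m + d)` is multiplication by a form of degree `d`. Over the open set where a variable
`X i` does not vanish `𝒪(m)` is generated by `X i ^ m`, so locally the morphism is multiplication by
a homogeneous fraction. The fractions agree at the generic point, hence define one fraction, which
can be written with a denominator outside any given relevant prime. By unique factorization it is a
form (`MvPolynomial.exists_isHomogeneous_eq_mul`). The common zero is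
`MvPolynomial.exists_homogeneous_prime`, and `ProjTwist.not_isSurjective_sum` draws the consequence
for sheaves.
-/

/-! ### Homogeneous polynomials -/

namespace MvPolynomial

attribute [local instance] MvPolynomial.gradedAlgebra

variable {k : Type u} [Field k]

/-- The kernel of setting the first `j` of the variables to zero. These ideals form a chain of
primes from `⊥` to the ideal of the origin. -/
noncomputable def coordinateIdeal (k : Type u) [Field k] (n j : ℕ) :
    Ideal (MvPolynomial (Fin n) k) :=
  RingHom.ker (aeval (R := k) fun i : Fin n =>
    if i.1 < j then (0 : MvPolynomial (Fin n) k) else X i)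

instance (n j : ℕ) : (coordinateIdeal k n j).IsPrime := RingHom.ker_isPrime _

theorem X_mem_coordinateIdeal_iff {n j : ℕ} (i : Fin n) :
    (X i : MvPolynomial (Fin n) k) ∈ coordinateIdeal k n j ↔ i.1 < j := by
  simp only [coordinateIdeal, RingHom.mem_ker, aeval_X, ite_eq_left_iff, X_ne_zero]
  tauto

theorem coordinateIdeal_lt {n j : ℕ} (hj : j < n) :
    coordinateIdeal k n j < coordinateIdeal k n (j + 1) := by
  refine lt_of_le_of_ne (fun p hp => ?_) fun h => ?_
  · have hcomp : (aeval (R := k) fun i : Fin n =>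
        if i.1 < j + 1 then (0 : MvPolynomial (Fin n) k) else X i) =
        (aeval fun i : Fin n => if i.1 < j + 1 then (0 : MvPolynomial (Fin n) k) else X i).comp
          (aeval fun i : Fin n => if i.1 < j then (0 : MvPolynomial (Fin n) k) else X i) := by
      ext1 i
      simp only [aeval_X, AlgHom.comp_apply]
      split_ifs <;> first | omega | simp_all
    rw [coordinateIdeal, RingHom.mem_ker] at hp ⊢
    rw [hcomp, AlgHom.comp_apply, hp, map_zero]
  · have h1 := (X_mem_coordinateIdeal_iff (k := k) (j := j + 1) ⟨j, hj⟩).2 (Nat.lt_succ_self j)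
    rw [← h, X_mem_coordinateIdeal_iff] at h1
    exact lt_irrefl _ h1

theorem le_height_coordinateIdeal {n j : ℕ} (hj : j ≤ n) :
    (j : ℕ∞) ≤ (coordinateIdeal k n j).height := by
  induction j with
  | zero => simp
  | succ j ih =>
    have := Ideal.height_add_one_le_of_lt_of_isPrime (coordinateIdeal_lt (k := k) hj)
    push_cast
    exact (add_le_add_left (ih (Nat.le_of_succ_le hj)) 1).trans this

theorem mem_coordinateIdeal_self_iff {n : ℕ} {p : MvPolynomial (Fin n) k} :
    p ∈ coordinateIdeal k n n ↔ constantCoeff p = 0 := by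
  have h : (aeval (R := k) fun i : Fin n =>
      if i.1 < n then (0 : MvPolynomial (Fin n) k) else X i) = aeval 0 := by
    congr 1
    ext1 i
    simp
  rw [coordinateIdeal, RingHom.mem_ker, h, aeval_zero]
  exact C_eq_zero

theorem coordinateIdeal_self_le (n : ℕ) :
    coordinateIdeal k n n ≤ Ideal.span (Set.range X) := by
  intro p hp
  rw [← Set.image_univ, mem_ideal_span_X_image]
  intro m hm
  by_contra! h
  refine mem_support_iff.1 hm ?_
  have : m = 0 := Finsupp.ext fun i => h i (Set.mem_univ i)
  rw [this]
  exact mem_coordinateIdeal_self_iff.1 hp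

theorem mem_coordinateIdeal_of_isHomogeneous {n d : ℕ} (hd : 0 < d) {f : MvPolynomial (Fin n) k}
    (hf : f.IsHomogeneous d) : f ∈ coordinateIdeal k n n := by
  rw [mem_coordinateIdeal_self_iff, constantCoeff_eq]
  exact hf.coeff_eq_zero (by simpa using hd.ne)

/-- Fewer forms of positive degree than there are variables have a common zero in projective
space: otherwise the ideal of the origin would be minimal over them, and Krull's height theorem
bounds its height by their number. -/
theorem exists_homogeneous_prime {n : ℕ} (s : Finset (MvPolynomial (Fin n) k)) (hs : s.card < n)
    {d : ℕ} (hd : 0 < d) (hf : ∀ f ∈ s, f.IsHomogeneous d) :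
    ∃ (P : Ideal (MvPolynomial (Fin n) k)) (i : Fin n), P.IsPrime ∧
      P.IsHomogeneous (homogeneousSubmodule (Fin n) k) ∧ (∀ f ∈ s, f ∈ P) ∧ X i ∉ P := by
  have hI : (Ideal.span (s : Set (MvPolynomial (Fin n) k))).IsHomogeneous
      (homogeneousSubmodule (Fin n) k) :=
    Ideal.homogeneous_span _ _ fun f h => ⟨d, hf f h⟩
  have hX : ∃ i : Fin n, X i ∉ (Ideal.span (s : Set (MvPolynomial (Fin n) k))).radical := by
    by_contra! h
    have hmin : coordinateIdeal k n n ∈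
        (Ideal.span (s : Set (MvPolynomial (Fin n) k))).minimalPrimes := by
      refine ⟨⟨inferInstance, Ideal.span_le.2 fun f h =>
        mem_coordinateIdeal_of_isHomogeneous hd (hf f h)⟩, fun J hJ _ => ?_⟩
      refine (coordinateIdeal_self_le n).trans (Ideal.span_le.2 ?_)
      rintro _ ⟨i, rfl⟩
      exact (hJ.1.radical_le_iff.2 hJ.2) (h i)
    have h1 := Ideal.height_le_card_of_mem_minimalPrimes_span_finset hmin
    have h2 := (le_height_coordinateIdeal (k := k) le_rfl).trans h1
    exact absurd (by exact_mod_cast h2) hs.not_ge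
  obtain ⟨i, hi⟩ := hX
  rw [hI.radical_eq, Submodule.mem_sInf] at hi
  push Not at hi
  obtain ⟨P, ⟨hP, hsP, hPp⟩, hiP⟩ := hi
  exact ⟨P, i, hPp, hP, fun f h => hsP (Ideal.subset_span h), hiP⟩

theorem isRelPrime_X_pow {n : ℕ} {i j : Fin n} (hij : i ≠ j) (a b : ℕ) :
    IsRelPrime (X i ^ a : MvPolynomial (Fin n) k) (X j ^ b) := by
  refine IsRelPrime.pow ((X_prime (i := i)).irreducible.isRelPrime_iff_not_dvd.2 ?_)
  rw [X_dvd_X]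
  simpa using hij

/-- A homogeneous fraction `r / s` in at least two variables that can be written with a denominator
outside each relevant homogeneous prime is a form: some powers of two of the variables are
denominators, and these are relatively prime. -/
theorem exists_isHomogeneous_eq_mul {n : ℕ} {i₀ i₁ : Fin n} (hne : i₀ ≠ i₁) {a b d : ℕ}
    (hd : a = b + d) {r s : MvPolynomial (Fin n) k} (hr : r.IsHomogeneous a)
    (hs : s.IsHomogeneous b) (hs0 : s ≠ 0)
    (h : ∀ (P : Ideal (MvPolynomial (Fin n) k)) (i : Fin n), P.IsPrime →
      P.IsHomogeneous (homogeneousSubmodule (Fin n) k) → X i ∉ P →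
      ∃ r' s', s' ∉ P ∧ r' * s = r * s') :
    ∃ f : MvPolynomial (Fin n) k, f.IsHomogeneous d ∧ r = s * f := by
  -- The ideal of denominators of `r / s` is homogeneous.
  let I : Ideal (MvPolynomial (Fin n) k) := (Ideal.span {s}).colon {r}
  have hmem : ∀ t, t ∈ I ↔ s ∣ t * r := fun t => by
    rw [Submodule.mem_colon_singleton, smul_eq_mul, Ideal.mem_span_singleton]
  have hI : I.IsHomogeneous (homogeneousSubmodule (Fin n) k) := by
    intro l t ht
    have hspan : (Ideal.span {s}).IsHomogeneous (homogeneousSubmodule (Fin n) k) :=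
      Ideal.homogeneous_span _ _ fun f h => ⟨b, (Set.mem_singleton_iff.1 h) ▸ hs⟩
    have ht' := hspan (l + a) (Ideal.mem_span_singleton.2 ((hmem t).1 ht))
    rw [DirectSum.coe_decompose_mul_add_of_right_mem _ hr] at ht'
    exact (hmem _).2 (Ideal.mem_span_singleton.1 ht')
  have hX : ∀ i : Fin n, ∃ N : ℕ, s ∣ X i ^ N * r := by
    intro i
    have : X i ∈ I.radical := by
      rw [hI.radical_eq, Submodule.mem_sInf]
      rintro P ⟨hP, hIP, hPp⟩
      by_contra hi
      obtain ⟨r', s', hs', e⟩ := h P i hPp hP hi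
      exact hs' (hIP ((hmem s').2 ⟨r', by rw [mul_comm s', ← e, mul_comm]⟩))
    obtain ⟨N, hN⟩ := this
    exact ⟨N, (hmem _).1 hN⟩
  obtain ⟨N, p, hp⟩ := hX i₀
  obtain ⟨M, q, hq⟩ := hX i₁
  have hpq : X i₁ ^ M * p = X i₀ ^ N * q := by
    refine mul_left_cancel₀ hs0 ?_
    linear_combination X i₀ ^ N * hq - X i₁ ^ M * hp
  obtain ⟨g, hg⟩ : X i₀ ^ N ∣ p :=
    (isRelPrime_X_pow hne N M).dvd_of_dvd_mul_left ⟨q, hpq⟩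
  have hrg : r = s * g := by
    refine mul_left_cancel₀ (pow_ne_zero N (X_ne_zero i₀)) ?_
    rw [hp, hg]
    ring
  -- Taking the component of degree `d` makes it unnecessary to show that `g` is homogeneous.
  refine ⟨DirectSum.decompose (homogeneousSubmodule (Fin n) k) g d,
    (mem_homogeneousSubmodule d _).1 (SetLike.coe_mem _), ?_⟩
  rw [← DirectSum.coe_decompose_mul_add_of_left_mem _ hs, ← hrg, ← hd,
    DirectSum.decompose_of_mem_same _ hr]

end MvPolynomial

/-! ### Sections of the twisting sheaves -/

namespace ProjTwist

noncomputable section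

variable {A σ : Type u} [CommRing A] [SetLike σ A] [AddSubgroupClass σ A]
variable {𝒜 : ℕ → σ} [GradedRing 𝒜]

/-- The value of a section of `𝒪(n)` at a point, as an element of `A_𝔭`. -/
def evalAt {n : ℤ} {U : (Proj 𝒜).Opens} (s : Γ(twist 𝒜 n, U)) (x : U) : LocAt 𝒜 x.1 :=
  (show sections 𝒜 n U from s).1 x

variable {n : ℤ} {U V : (Proj 𝒜).Opens}

theorem evalAt_ext {s t : Γ(twist 𝒜 n, U)} (h : ∀ x, evalAt s x = evalAt t x) : s = t :=
  Subtype.ext (funext h)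

theorem evalAt_smul (r : Γ(Proj 𝒜, U)) (s : Γ(twist 𝒜 n, U)) (x : U) :
    evalAt (r • s) x = value 𝒜 r x * evalAt s x :=
  rfl

theorem evalAt_map (i : V ⟶ U) (s : Γ(twist 𝒜 n, U)) (x : V) :
    evalAt ((twist 𝒜 n).presheaf.map i.op s) x = evalAt s (i x) :=
  rfl

/-- A section of `𝒪(n)` is near each point one fraction of degree `n`. -/
theorem exists_fraction (s : Γ(twist 𝒜 n, U)) (x : U) :
    ∃ (V : (Proj 𝒜).Opens) (_ : x.1 ∈ V) (i : V ⟶ U) (a b : ℕ) (p q : A), p ∈ 𝒜 a ∧ q ∈ 𝒜 b ∧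
      (a : ℤ) = b + n ∧ ∀ y : V, q ∉ (pt 𝒜 y.1).asHomogeneousIdeal ∧
        algebraMap A (LocAt 𝒜 y.1) q * evalAt s (i y) = algebraMap A (LocAt 𝒜 y.1) p := by
  obtain ⟨V, hxV, i, a, b, p, q, hp, hq, hd, h⟩ := (show sections 𝒜 n U from s).2 x
  exact ⟨V, hxV, i, a, b, p, q, hp, hq, hd, h⟩

theorem isUnit_algebraMap {x : Proj 𝒜} {q : A} (hq : q ∉ (pt 𝒜 x).asHomogeneousIdeal) :
    IsUnit (algebraMap A (LocAt 𝒜 x) q) :=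
  IsLocalization.map_units (LocAt 𝒜 x)
    (⟨q, hq⟩ : (pt 𝒜 x).asHomogeneousIdeal.toIdeal.primeCompl)

theorem notMem_of_isUnit_algebraMap {x : Proj 𝒜} {q : A}
    (hq : IsUnit (algebraMap A (LocAt 𝒜 x) q)) : q ∉ (pt 𝒜 x).asHomogeneousIdeal :=
  (IsLocalization.AtPrime.isUnit_to_map_iff (LocAt 𝒜 x)
    (pt 𝒜 x).asHomogeneousIdeal.toIdeal q).1 hq

variable (n U) in
/-- The section `p / q` of `𝒪(n)` over an open set on which `q` has no zeros. -/
def fractionSection {a b : ℕ} {p q : A} (hp : p ∈ 𝒜 a) (hq : q ∈ 𝒜 b) (hd : (a : ℤ) = b + n)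
    (hU : ∀ x : U, q ∉ (pt 𝒜 x.1).asHomogeneousIdeal) : Γ(twist 𝒜 n, U) :=
  (⟨fun x => IsLocalization.mk' (LocAt 𝒜 x.1) p
      (⟨q, hU x⟩ : (pt 𝒜 x.1).asHomogeneousIdeal.toIdeal.primeCompl),
    fun x => ⟨U, x.2, 𝟙 U, a, b, p, q, hp, hq, hd, fun y => ⟨hU y,
      IsLocalization.mk'_spec' (LocAt 𝒜 y.1) p
        (⟨q, hU y⟩ : (pt 𝒜 y.1).asHomogeneousIdeal.toIdeal.primeCompl)⟩⟩⟩ : sections 𝒜 n U)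

theorem algebraMap_mul_evalAt_fractionSection {a b : ℕ} {p q : A} (hp : p ∈ 𝒜 a) (hq : q ∈ 𝒜 b)
    (hd : (a : ℤ) = b + n) (hU : ∀ x : U, q ∉ (pt 𝒜 x.1).asHomogeneousIdeal) (x : U) :
    algebraMap A (LocAt 𝒜 x.1) q * evalAt (fractionSection n U hp hq hd hU) x =
      algebraMap A (LocAt 𝒜 x.1) p :=
  IsLocalization.mk'_spec' (LocAt 𝒜 x.1) p
    (⟨q, hU x⟩ : (pt 𝒜 x.1).asHomogeneousIdeal.toIdeal.primeCompl)

theorem value_injective {r s : Γ(Proj 𝒜, U)} (h : ∀ x, value 𝒜 r x = value 𝒜 s x) : r = s :=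
  Subtype.ext (funext fun x => HomogeneousLocalization.val_injective _ (h x))

/-- Families that are locally fractions of degree `0` are regular functions. -/
theorem exists_value_eq {f : ∀ x : U, LocAt 𝒜 x.1} (hf : (isLocallyFraction 𝒜 0).pred f) :
    ∃ r : Γ(Proj 𝒜, U), ∀ x, value 𝒜 r x = f x := by
  have key : ∀ x : U, ∃ (V : (Proj 𝒜).Opens) (_ : x.1 ∈ V) (i : V ⟶ U) (a : ℕ) (p q : 𝒜 a)
      (hq : ∀ y : V, q.1 ∉ (pt 𝒜 y.1).asHomogeneousIdeal), ∀ y : V,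
      f (i y) = (HomogeneousLocalization.mk ⟨a, p, q, hq y⟩ : HomogeneousLocalization.AtPrime 𝒜
        (pt 𝒜 y.1).asHomogeneousIdeal.toIdeal).val := by
    intro x
    obtain ⟨V, hxV, i, a, b, p, q, hp, hq, hd, h⟩ := hf x
    obtain rfl : a = b := by lia
    refine ⟨V, hxV, i, a, ⟨p, hp⟩, ⟨q, hq⟩, fun y => (h y).1, fun y => ?_⟩
    have e : (HomogeneousLocalization.mk ⟨a, ⟨p, hp⟩, ⟨q, hq⟩, (h y).1⟩ :
        HomogeneousLocalization.AtPrime 𝒜 (pt 𝒜 y.1).asHomogeneousIdeal.toIdeal).val =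
        IsLocalization.mk' (LocAt 𝒜 y.1) p
          (⟨q, (h y).1⟩ : (pt 𝒜 y.1).asHomogeneousIdeal.toIdeal.primeCompl) :=
      (HomogeneousLocalization.val_mk _).trans (Localization.mk_eq_mk'_apply _ _)
    refine (isUnit_algebraMap (h y).1).mul_left_cancel ((h y).2.trans ?_)
    exact (IsLocalization.mk'_spec' (LocAt 𝒜 y.1) p
      (⟨q, (h y).1⟩ : (pt 𝒜 y.1).asHomogeneousIdeal.toIdeal.primeCompl)).symm.trans
        (congrArg _ e.symm)
  have hval : ∀ x : U, ∃ z : HomogeneousLocalization.AtPrime 𝒜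
      (pt 𝒜 x.1).asHomogeneousIdeal.toIdeal, z.val = f x := by
    intro x
    obtain ⟨V, hxV, i, a, p, q, hq, h⟩ := key x
    exact ⟨_, (h ⟨x.1, hxV⟩).symm⟩
  choose z hz using hval
  refine ⟨⟨z, fun x => ?_⟩, hz⟩
  obtain ⟨V, hxV, i, a, p, q, hq, h⟩ := key x
  refine ⟨V, hxV, i, a, p, q, hq, fun y => HomogeneousLocalization.val_injective _ ?_⟩
  exact (hz (i y)).trans (h y)

/-- A nowhere vanishing section of `𝒪(n)` generates it. -/
theorem bijective_smul_of_isUnit {e : Γ(twist 𝒜 n, U)} (he : ∀ x, IsUnit (evalAt e x)) :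
    Function.Bijective fun r : Γ(Proj 𝒜, U) => r • e := by
  refine ⟨fun r s h => value_injective fun x => ?_, fun s => ?_⟩
  · refine (he x).mul_right_cancel ?_
    rw [← evalAt_smul, ← evalAt_smul]
    exact congrArg (evalAt · x) h
  · have hf : (isLocallyFraction 𝒜 0).pred (U := U)
        fun x => evalAt s x * ((he x).unit⁻¹ : (LocAt 𝒜 x.1)ˣ) := by
      intro x
      obtain ⟨V, hxV, i, a, b, p, q, hp, hq, hd, h⟩ := exists_fraction s x
      obtain ⟨V', hxV', i', a', b', p', q', hp', hq', hd', h'⟩ := exists_fraction e x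
      refine ⟨V ⊓ V', ⟨hxV, hxV'⟩, Opens.infLELeft _ _ ≫ i, a + b', b + a', p * q', q * p',
        SetLike.mul_mem_graded hp hq', SetLike.mul_mem_graded hq hp', by push_cast; lia,
        fun y => ?_⟩
      have h1 := h ⟨y.1, y.2.1⟩
      have h2 := h' ⟨y.1, y.2.2⟩
      have h3 : p' ∉ (pt 𝒜 y.1).asHomogeneousIdeal := notMem_of_isUnit_algebraMap
        (h2.2 ▸ (isUnit_algebraMap h2.1).mul (he (i' ⟨y.1, y.2.2⟩)))
      refine ⟨fun hm => ((pt 𝒜 y.1).isPrime.mem_or_mem hm).elim h1.1 h3, ?_⟩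
      have h4 := (he (i' ⟨y.1, y.2.2⟩)).mul_val_inv
      have h12 := h1.2
      have h22 := h2.2
      change algebraMap A (LocAt 𝒜 y.1) (q * p') * (evalAt s (i ⟨y.1, y.2.1⟩) *
        ((he (i' ⟨y.1, y.2.2⟩)).unit⁻¹ : (LocAt 𝒜 y.1)ˣ)) = algebraMap A (LocAt 𝒜 y.1) (p * q')
      rw [map_mul, map_mul, ← h12, ← h22]
      linear_combination algebraMap A (LocAt 𝒜 y.1) q * algebraMap A (LocAt 𝒜 y.1) q' *
        evalAt s (i ⟨y.1, y.2.1⟩) * h4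
    obtain ⟨r, hr⟩ := exists_value_eq hf
    refine ⟨r, evalAt_ext fun x => ?_⟩
    rw [evalAt_smul, hr, mul_assoc, IsUnit.val_inv_mul, mul_one]

/-- The section `f ^ n` of `𝒪(n)` over an open set on which the form `f` of degree `1` has no
zeros. For `n < 0` it is the fraction `1 / f ^ (-n)`. -/
def powSection {f : A} (hf : f ∈ 𝒜 1) (n : ℤ)
    (hU : ∀ x : U, f ∉ (pt 𝒜 x.1).asHomogeneousIdeal) : Γ(twist 𝒜 n, U) :=
  fractionSection n U (a := n.toNat) (b := (-n).toNat) (p := f ^ n.toNat) (q := f ^ (-n).toNat)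
    (by simpa using SetLike.pow_mem_graded n.toNat hf)
    (by simpa using SetLike.pow_mem_graded (-n).toNat hf) (by lia)
    fun x h => hU x ((pt 𝒜 x.1).isPrime.mem_of_pow_mem _ h)

theorem algebraMap_mul_evalAt_powSection {f : A} (hf : f ∈ 𝒜 1) (n : ℤ)
    (hU : ∀ x : U, f ∉ (pt 𝒜 x.1).asHomogeneousIdeal) (x : U) :
    algebraMap A (LocAt 𝒜 x.1) (f ^ (-n).toNat) * evalAt (powSection hf n hU) x =
      algebraMap A (LocAt 𝒜 x.1) (f ^ n.toNat) :=
  algebraMap_mul_evalAt_fractionSection _ _ _ _ x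

theorem isUnit_evalAt_powSection {f : A} (hf : f ∈ 𝒜 1) (n : ℤ)
    (hU : ∀ x : U, f ∉ (pt 𝒜 x.1).asHomogeneousIdeal) (x : U) :
    IsUnit (evalAt (powSection hf n hU) x) := by
  refine isUnit_of_mul_isUnit_right
    (x := algebraMap A (LocAt 𝒜 x.1) (f ^ (-n).toNat)) ?_
  rw [algebraMap_mul_evalAt_powSection, map_pow]
  exact (isUnit_algebraMap (hU x)).pow _

theorem isLineBundle_twist
    (h : ∀ x : Proj 𝒜, ∃ f ∈ 𝒜 1, f ∉ (pt 𝒜 x).asHomogeneousIdeal) (n : ℤ) :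
    SheafMonad.IsLineBundle (twist 𝒜 n) := by
  intro x
  obtain ⟨f, hf, hx⟩ := h x
  let D : (Proj 𝒜).Opens := ProjectiveSpectrum.basicOpen 𝒜 f
  have hD : ∀ y : D, f ∉ (pt 𝒜 y.1).asHomogeneousIdeal := fun y => y.2
  refine ⟨D, hx, powSection hf n hD, fun V i => ?_⟩
  refine bijective_smul_of_isUnit (e := (twist 𝒜 n).presheaf.map i.op (powSection hf n hD))
    fun y => ?_
  rw [evalAt_map]
  exact isUnit_evalAt_powSection hf n hD (i y)

/-! ### Morphisms between twisting sheaves -/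

theorem app_map {m : ℤ} (φ : twist 𝒜 m ⟶ twist 𝒜 n) (i : V ⟶ U) (s : Γ(twist 𝒜 m, U)) :
    φ.app V ((twist 𝒜 m).presheaf.map i.op s) = (twist 𝒜 n).presheaf.map i.op (φ.app U s) :=
  ConcreteCategory.congr_hom (φ.mapPresheaf.naturality i.op) s

/-- Linearity determines a morphism near a point by its value on a local generator `e`. -/
theorem evalAt_app_mul {m : ℤ} (φ : twist 𝒜 m ⟶ twist 𝒜 n) (s : Γ(twist 𝒜 m, U))
    {e : Γ(twist 𝒜 m, V)} (he : ∀ x, IsUnit (evalAt e x)) {x : Proj 𝒜} (hU : x ∈ U)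
    (hV : x ∈ V) :
    evalAt (φ.app U s) ⟨x, hU⟩ * evalAt e ⟨x, hV⟩ =
      evalAt s ⟨x, hU⟩ * evalAt (φ.app V e) ⟨x, hV⟩ := by
  let i : U ⊓ V ⟶ U := Opens.infLELeft _ _
  let j : U ⊓ V ⟶ V := Opens.infLERight _ _
  obtain ⟨r, hr⟩ := (bijective_smul_of_isUnit (e := (twist 𝒜 m).presheaf.map j.op e)
    fun x => he (j x)).2 ((twist 𝒜 m).presheaf.map i.op s)
  have hr' := congrArg (φ.app (U ⊓ V)) hr
  dsimp only at hr hr'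
  rw [Scheme.Modules.Hom.app_smul, app_map, app_map] at hr'
  let y : ↥(U ⊓ V) := ⟨x, hU, hV⟩
  have h1 := congrArg (fun t => evalAt t y) hr
  have h2 := congrArg (fun t => evalAt t y) hr'
  dsimp only at h1 h2
  rw [evalAt_smul, evalAt_map, evalAt_map] at h1 h2
  change _ * evalAt e ⟨x, hV⟩ = evalAt s ⟨x, hU⟩ at h1
  change _ * evalAt (φ.app V e) ⟨x, hV⟩ = evalAt (φ.app U s) ⟨x, hU⟩ at h2
  rw [← h1, ← h2]
  ring

end

end ProjTwist

/-! ### Twisting sheaves on projective space -/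

namespace ProjTwist

noncomputable section

attribute [local instance] MvPolynomial.gradedAlgebra

open MvPolynomial (X homogeneousSubmodule)

variable {k : Type u} [Field k] {N : ℕ}

/-- The point of projective space given by a homogeneous prime that does not contain the
variable `X i`. -/
def ofPrime (P : Ideal (MvPolynomial (Fin N) k)) [hP : P.IsPrime]
    (hhom : P.IsHomogeneous (homogeneousSubmodule (Fin N) k)) (i : Fin N) (hi : X i ∉ P) :
    Proj (homogeneousSubmodule (Fin N) k) :=
  (⟨⟨P, hhom⟩, hP, fun h => hi (h ((HomogeneousIdeal.mem_irrelevant_iff _ _).2 (by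
    rw [GradedRing.proj_apply]
    exact DirectSum.decompose_of_mem_ne _ (MvPolynomial.isHomogeneous_X k i) one_ne_zero)))⟩ :
    ProjectiveSpectrum (homogeneousSubmodule (Fin N) k))

variable (k) in
/-- The generic point of projective space. -/
def generic (i : Fin N) : Proj (homogeneousSubmodule (Fin N) k) :=
  have : (⊥ : Ideal (MvPolynomial (Fin N) k)).IsPrime := Ideal.isPrime_bot
  ofPrime ⊥ (Ideal.IsHomogeneous.bot _) i fun h => MvPolynomial.X_ne_zero i (Ideal.mem_bot.1 h)

theorem generic_mem (i : Fin N) {U : (Proj (homogeneousSubmodule (Fin N) k)).Opens}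
    {x : Proj (homogeneousSubmodule (Fin N) k)} (hx : x ∈ U) : generic k i ∈ U := by
  have h : (pt _ x) ∈ closure {pt _ (generic k i)} := by
    rw [← ProjectiveSpectrum.le_iff_mem_closure]
    exact (bot_le : (⊥ : Ideal (MvPolynomial (Fin N) k)) ≤ _)
  obtain ⟨y, hy, rfl⟩ := mem_closure_iff.1 h U.1 U.2 hx
  exact hy

theorem algebraMap_generic_injective (i : Fin N) :
    Function.Injective (algebraMap (MvPolynomial (Fin N) k) (LocAt _ (generic k i))) :=
  IsLocalization.injective _ (M := (pt _ (generic k i)).asHomogeneousIdeal.toIdeal.primeCompl)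
    (Ideal.primeCompl_le_nonZeroDivisors _)

theorem exists_X_notMem (x : Proj (homogeneousSubmodule (Fin N) k)) :
    ∃ i : Fin N, (X i : MvPolynomial (Fin N) k) ∉ (pt _ x).asHomogeneousIdeal := by
  obtain ⟨f, m, hf, hm, hx⟩ := exists_homogeneous_notMem _ x
  by_contra! h
  refine hx ((Ideal.span_le.2 ?_ : Ideal.span (Set.range X) ≤ _)
    (MvPolynomial.coordinateIdeal_self_le N
      (MvPolynomial.mem_coordinateIdeal_of_isHomogeneous hm hf)))
  rintro _ ⟨i, rfl⟩
  exact h i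

/-- A morphism `𝒪(m) ⟶ 𝒪(m + d)` is multiplication by a form of degree `d`. Near each point it
is multiplication by a fraction of degree `d`, and all these fractions agree at the generic
point. -/
theorem exists_form {i₀ i₁ : Fin N} (hne : i₀ ≠ i₁) {m n : ℤ} {d : ℕ} (hd : n = m + d)
    (φ : twist (homogeneousSubmodule (Fin N) k) m ⟶ twist (homogeneousSubmodule (Fin N) k) n) :
    ∃ F : MvPolynomial (Fin N) k, F.IsHomogeneous d ∧
      ∀ (U : (Proj (homogeneousSubmodule (Fin N) k)).Opens)
        (s : Γ(twist (homogeneousSubmodule (Fin N) k) m, U)) (x : U),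
        evalAt (φ.app U s) x = algebraMap _ (LocAt _ x.1) F * evalAt s x := by
  have hX : ∀ i : Fin N, (X i : MvPolynomial (Fin N) k) ∈ homogeneousSubmodule (Fin N) k 1 :=
    fun i => MvPolynomial.isHomogeneous_X k i
  let D : Fin N → (Proj (homogeneousSubmodule (Fin N) k)).Opens :=
    fun i => ProjectiveSpectrum.basicOpen _ (X i)
  have hD : ∀ i, ∀ y : D i, (X i : MvPolynomial (Fin N) k) ∉ (pt _ y.1).asHomogeneousIdeal :=
    fun i y => y.2
  let e : ∀ i, Γ(twist (homogeneousSubmodule (Fin N) k) m, D i) :=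
    fun i => powSection (hX i) m (hD i)
  have he : ∀ i y, IsUnit (evalAt (e i) y) := fun i => isUnit_evalAt_powSection (hX i) m (hD i)
  have hη : ∀ i, generic k i₀ ∈ D i := fun i h =>
    MvPolynomial.X_ne_zero (R := k) i (Ideal.mem_bot.1 h)
  -- The fractions `r / s` below are `φ (X i ^ m) / X i ^ m`, with the sign of `m` sorted out.
  have local_fraction : ∀ (x : Proj (homogeneousSubmodule (Fin N) k)) (i : Fin N) (hx : x ∈ D i),
      ∃ (a b : ℕ) (r s : MvPolynomial (Fin N) k), r.IsHomogeneous a ∧ s.IsHomogeneous b ∧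
        a = b + d ∧ s ∉ (pt _ x).asHomogeneousIdeal ∧
        algebraMap _ (LocAt _ x) s * evalAt (φ.app _ (e i)) ⟨x, hx⟩ =
          algebraMap _ (LocAt _ x) r * evalAt (e i) ⟨x, hx⟩ ∧
        algebraMap _ (LocAt _ (generic k i₀)) s * evalAt (φ.app _ (e i)) ⟨_, hη i⟩ =
          algebraMap _ (LocAt _ (generic k i₀)) r * evalAt (e i) ⟨_, hη i⟩ := by
    intro x i hx
    obtain ⟨V, hxV, j, a, b, p, q, hp, hq, hab, h⟩ := exists_fraction (φ.app _ (e i)) ⟨x, hx⟩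
    have hqx := (h ⟨x, hxV⟩).1
    have key : ∀ y : V, algebraMap _ (LocAt _ y.1) (q * X i ^ m.toNat) *
        evalAt (φ.app _ (e i)) (j y) =
        algebraMap _ (LocAt _ y.1) (p * X i ^ (-m).toNat) * evalAt (e i) (j y) := by
      intro y
      have h1 := (h y).2
      have h2 := algebraMap_mul_evalAt_powSection (hX i) m (hD i) (j y)
      change _ * evalAt (e i) (j y) = _ at h2
      change algebraMap _ (LocAt _ (j y).1) q * _ = algebraMap _ (LocAt _ (j y).1) p at h1
      change algebraMap _ (LocAt _ (j y).1) _ * _ = algebraMap _ (LocAt _ (j y).1) _ * _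
      rw [map_mul, map_mul, ← h1, ← h2]
      ring
    refine ⟨a + (-m).toNat, b + m.toNat, p * X i ^ (-m).toNat, q * X i ^ m.toNat,
      hp.mul (MvPolynomial.isHomogeneous_X_pow i _), hq.mul (MvPolynomial.isHomogeneous_X_pow i _),
      by lia, fun hm => ?_, key ⟨x, hxV⟩, key ⟨_, generic_mem i₀ hxV⟩⟩
    exact ((pt _ x).isPrime.mem_or_mem hm).elim hqx
      fun h' => hx ((pt _ x).isPrime.mem_of_pow_mem _ h')
  have inj := algebraMap_generic_injective (k := k) i₀
  obtain ⟨a, b, r, s, hr, hs, hab, hs0, -, hrs⟩ := local_fraction (generic k i₀) i₀ (hη i₀)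
  have hs0 : s ≠ 0 := fun h => hs0 (h ▸ zero_mem _)
  have compare : ∀ (i : Fin N) (r' s' : MvPolynomial (Fin N) k),
      algebraMap _ (LocAt _ (generic k i₀)) s' * evalAt (φ.app _ (e i)) ⟨_, hη i⟩ =
        algebraMap _ (LocAt _ (generic k i₀)) r' * evalAt (e i) ⟨_, hη i⟩ → r' * s = r * s' := by
    intro i r' s' h
    apply inj
    have h1 := evalAt_app_mul φ (e i) (he i₀) (hη i) (hη i₀)
    refine (he i ⟨_, hη i⟩).mul_right_cancel ((he i₀ ⟨_, hη i₀⟩).mul_right_cancel ?_)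
    rw [map_mul, map_mul]
    linear_combination algebraMap _ (LocAt _ (generic k i₀)) s *
      algebraMap _ (LocAt _ (generic k i₀)) s' * h1
      - algebraMap _ (LocAt _ (generic k i₀)) s * evalAt (e i₀) ⟨_, hη i₀⟩ * h +
      algebraMap _ (LocAt _ (generic k i₀)) s' * evalAt (e i) ⟨_, hη i⟩ * hrs
  obtain ⟨F, hF, hrF⟩ := MvPolynomial.exists_isHomogeneous_eq_mul hne hab hr hs hs0
    fun P i hP hhom hi => by
      obtain ⟨_, _, r', s', -, -, -, hs', -, h⟩ := local_fraction (ofPrime P hhom i hi) i hi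
      exact ⟨r', s', hs', compare i r' s' h⟩
  refine ⟨F, hF, fun U t x => ?_⟩
  obtain ⟨i, hi⟩ := exists_X_notMem x.1
  obtain ⟨_, _, r', s', -, -, -, hs', h, h'⟩ := local_fraction x.1 i hi
  have hr' : r' = s' * F := by
    refine mul_right_cancel₀ hs0 ?_
    rw [compare i r' s' h', hrF]
    ring
  have hφe : evalAt (φ.app _ (e i)) ⟨x.1, hi⟩ =
      algebraMap _ (LocAt _ x.1) F * evalAt (e i) ⟨x.1, hi⟩ := by
    refine (isUnit_algebraMap hs').mul_left_cancel ?_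
    rw [h, hr', map_mul, mul_assoc]
  refine (he i ⟨x.1, hi⟩).mul_right_cancel ?_
  have h1 := evalAt_app_mul φ t (he i) x.2 hi
  rw [hφe] at h1
  rw [mul_assoc, mul_comm (evalAt t x)]
  refine h1.trans ?_
  change evalAt t x * _ = _
  ring

/-- A nonzero endomorphism of `𝒪(n)` is multiplication by a nonzero constant. -/
theorem isIso_of_ne_zero {i₀ i₁ : Fin N} (hne : i₀ ≠ i₁) {m n : ℤ} (hmn : m = n)
    (φ : twist (homogeneousSubmodule (Fin N) k) m ⟶ twist (homogeneousSubmodule (Fin N) k) n)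
    (h : φ ≠ 0) : IsIso φ := by
  subst hmn
  obtain ⟨F, hF, hφ⟩ := exists_form hne (d := 0) (by simp) φ
  have hF0 : F ≠ 0 := by
    rintro rfl
    refine h (Scheme.Modules.hom_ext _ _ fun U => ?_)
    ext s
    refine evalAt_ext fun x => ?_
    rw [hφ, map_zero, zero_mul]
    rfl
  obtain ⟨c, rfl⟩ : ∃ c, F = MvPolynomial.C c := ⟨_, MvPolynomial.totalDegree_eq_zero_iff_eq_C.1
    ((MvPolynomial.totalDegree_zero_iff_isHomogeneous _).2 hF)⟩
  have hc : MvPolynomial.C c⁻¹ * MvPolynomial.C c = (1 : MvPolynomial (Fin N) k) := by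
    rw [← map_mul, inv_mul_cancel₀ (fun h => hF0 (by rw [h, map_zero])), map_one]
  rw [Scheme.Modules.Hom.isIso_iff_isIso_app]
  intro U
  rw [ConcreteCategory.isIso_iff_bijective]
  refine ⟨fun s t hst => evalAt_ext fun x => ?_, fun t => ?_⟩
  · have hst' := congrArg (fun z => evalAt z x) hst
    rw [hφ, hφ] at hst'
    exact (IsUnit.of_mul_eq_one_right _ (by rw [← map_mul, hc, map_one])).mul_left_cancel hst'
  · have hconst : (isLocallyFraction (homogeneousSubmodule (Fin N) k) 0).pred (U := U)
        fun x => algebraMap _ (LocAt _ x.1) (MvPolynomial.C c⁻¹) := fun x =>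
      ⟨U, x.2, 𝟙 U, 0, 0, MvPolynomial.C c⁻¹, 1, MvPolynomial.isHomogeneous_C _ _,
        MvPolynomial.isHomogeneous_one _ _, by simp, fun y =>
          ⟨fun h => (pt _ y.1).isPrime.ne_top ((Ideal.eq_top_iff_one _).2 h), by
            rw [map_one, one_mul]
            rfl⟩⟩
    obtain ⟨r, hr⟩ := exists_value_eq hconst
    refine ⟨r • t, evalAt_ext fun x => ?_⟩
    rw [hφ, evalAt_smul, hr, ← mul_assoc, ← map_mul, mul_comm (MvPolynomial.C c), hc, map_one,
      one_mul]

variable (k) in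
theorem not_isZero_twist (i : Fin N) (n : ℤ) :
    ¬ IsZero (twist (homogeneousSubmodule (Fin N) k) n) := by
  intro h
  let D : (Proj (homogeneousSubmodule (Fin N) k)).Opens := ProjectiveSpectrum.basicOpen _ (X i)
  have hD : ∀ y : D, (X i : MvPolynomial (Fin N) k) ∉ (pt _ y.1).asHomogeneousIdeal := fun y => y.2
  have hη : generic k i ∈ D := fun h => MvPolynomial.X_ne_zero (R := k) i (Ideal.mem_bot.1 h)
  have h0 := congrArg (fun φ => evalAt (Scheme.Modules.Hom.app φ D
    (powSection (MvPolynomial.isHomogeneous_X k i) n hD)) ⟨_, hη⟩) ((IsZero.iff_id_eq_zero _).1 h)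
  have hu := isUnit_evalAt_powSection (MvPolynomial.isHomogeneous_X k i) n hD ⟨_, hη⟩
  change evalAt (powSection (MvPolynomial.isHomogeneous_X k i) n hD) ⟨_, hη⟩ = 0 at h0
  rw [h0, isUnit_zero_iff] at hu
  refine zero_ne_one (α := MvPolynomial (Fin N) k) (algebraMap_generic_injective i ?_)
  rw [map_zero, map_one]
  exact hu

/-- A sum of morphisms that factor through forms of degree `d > 0`, fewer in number than the
variables, is not surjective, since the forms have a common zero. -/
theorem not_isSurjective_sum {i₀ i₁ : Fin N} (hne : i₀ ≠ i₁) {ι : Type*} [Fintype ι]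
    (hι : Fintype.card ι < N) {m : ι → ℤ} {n : ℤ} {d : ℕ} (hd : 0 < d) (hmn : ∀ j, n = m j + d)
    {B : (Proj (homogeneousSubmodule (Fin N) k)).Modules}
    (p : ∀ j, B ⟶ twist (homogeneousSubmodule (Fin N) k) (m j))
    (φ : ∀ j, twist (homogeneousSubmodule (Fin N) k) (m j) ⟶
      twist (homogeneousSubmodule (Fin N) k) n) :
    ¬ SheafMonad.IsSurjective (∑ j, p j ≫ φ j) := by
  classical
  intro hsurj
  choose F hF hφ using fun j => exists_form hne (hmn j) (φ j)
  obtain ⟨P, i, hP, hhom, hFP, hi⟩ := MvPolynomial.exists_homogeneous_prime (Finset.univ.image F)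
    (Finset.card_image_le.trans_lt hι) hd (by simpa using hF)
  let x := ofPrime P hhom i hi
  let D : (Proj (homogeneousSubmodule (Fin N) k)).Opens := ProjectiveSpectrum.basicOpen _ (X i)
  have hD : ∀ y : D, (X i : MvPolynomial (Fin N) k) ∉ (pt _ y.1).asHomogeneousIdeal := fun y => y.2
  let e := powSection (MvPolynomial.isHomogeneous_X k i) n hD
  obtain ⟨V, hVD, ⟨s, hs⟩, hxV⟩ := (TopCat.Presheaf.isLocallySurjective_iff _).1 hsurj D e x hi
  have hmem : ∀ t : Finset ι, evalAt (Scheme.Modules.Hom.app (∑ j ∈ t, p j ≫ φ j) V s) ⟨x, hxV⟩ ∈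
      P.map (algebraMap _ (LocAt _ x)) := by
    intro t
    induction t using Finset.induction_on with
    | empty => exact zero_mem _
    | insert j t hj ih =>
      rw [Finset.sum_insert hj]
      refine add_mem (?_ : evalAt ((φ j).app V ((p j).app V s)) ⟨x, hxV⟩ ∈ _) ih
      rw [hφ]
      exact Ideal.mul_mem_right _ _ (Ideal.mem_map_of_mem _ (hFP _ (by simp)))
  have hunit : IsUnit (evalAt (Scheme.Modules.Hom.app (∑ j, p j ≫ φ j) V s) ⟨x, hxV⟩) := by
    have hs' := congrArg (fun t : Γ(twist (homogeneousSubmodule (Fin N) k) n, V) =>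
      evalAt t ⟨x, hxV⟩) hs
    exact hs' ▸ isUnit_evalAt_powSection (MvPolynomial.isHomogeneous_X k i) n hD ⟨x, hi⟩
  have : IsLocalization P.primeCompl (LocAt _ x) :=
    inferInstanceAs (IsLocalization.AtPrime (LocAt _ x) (pt _ x).asHomogeneousIdeal.toIdeal)
  refine (IsLocalization.map_algebraMap_ne_top_iff_disjoint P.primeCompl (LocAt _ x) P).2 ?_
    (Ideal.eq_top_of_isUnit_mem _ (hmem _) hunit)
  exact Set.disjoint_left.2 fun _ h => h

end

end ProjTwist

/-! ### Minimal monads -/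

section

attribute [local instance] MvPolynomial.gradedAlgebra Abelian.hasFiniteBiproducts

open ProjTwist
open MvPolynomial (X homogeneousSubmodule)

namespace SheafMonad

/-- A line bundle `L` that is a direct summand of `B` and that `α` carries isomorphically onto a
quotient of `A` obstructs minimality: the isomorphism yields a retraction of `L ⟶ A`. -/
theorem not_isMinimal_of_isIso {X : Scheme.{u}} {C B A L L' : X.Modules} (M : SheafMonad C B A)
    (hL : IsLineBundle L) (hL0 : ¬ IsZero L) (i : L ⟶ B) [IsSplitMono i] (p : A ⟶ L')
    [IsIso (i ≫ M.α ≫ p)] : ¬ M.IsMinimal := by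
  intro h
  refine h.1 ⟨L, i, hL, fun x => ⟨⊤, trivial, inferInstance⟩, L, 𝟙 L, i ≫ M.α, hL0, ?_, ?_,
    Category.id_comp _⟩
  · have : IsIso (𝟙 L : L ⟶ L).mapPresheaf :=
      inferInstanceAs (IsIso ((Scheme.Modules.toPresheaf X).map (𝟙 L)))
    exact (TopCat.Presheaf.isLocallySurjective_iff _).2 fun U t x hx =>
      ⟨U, le_rfl, ⟨t, (ConcreteCategory.congr_hom (X := Γ(L, U)) (L.presheaf.map_id _) t).symm⟩, hx⟩
  · exact ⟨⟨⟨p ≫ inv (i ≫ M.α ≫ p), by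
      rw [← Category.assoc, Category.assoc i, IsIso.hom_inv_id]⟩⟩⟩

theorem IsSurjective.comp_of_isSplitEpi {X : Scheme.{u}} {F G H : X.Modules} {φ : F ⟶ G}
    (hφ : IsSurjective φ) (p : G ⟶ H) [IsSplitEpi p] : IsSurjective (φ ≫ p) := by
  refine (TopCat.Presheaf.isLocallySurjective_iff _).2 fun U t x hx => ?_
  obtain ⟨V, hV, ⟨s, hs⟩, hxV⟩ := (TopCat.Presheaf.isLocallySurjective_iff _).1 hφ U
    ((section_ p).app U t) x hx
  refine ⟨V, hV, ⟨s, ?_⟩, hxV⟩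
  have h1 := ConcreteCategory.congr_hom (p.mapPresheaf.naturality (homOfLE hV).op)
    ((section_ p).app U t)
  have h2 : p.app U ((section_ p).app U t) = t :=
    ConcreteCategory.congr_hom (congrArg (fun ψ => Scheme.Modules.Hom.app ψ U)
      (IsSplitEpi.id p)) t
  change p.app V (φ.app V s) = _
  refine (congrArg _ hs).trans (h1.trans ?_)
  exact congrArg (H.presheaf.map (homOfLE hV).op) h2

end SheafMonad

/-- There are no minimal monads
`𝒪(-2) ⊕ 𝒪(-4) ⟶ 𝒪(1)³ ⊕ 𝒪(-2)³ ⟶ 𝒪(1) ⊕ 𝒪(3)` on projective 3-space. -/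
theorem proposition6p3 (k : Type u) [Field k] : ¬ ∃ M : MonadP15 k, M.IsMinimal := by
  rintro ⟨M, hM⟩
  have hne : (0 : Fin 4) ≠ 1 := by decide
  let a : Fin 2 → ℤ := ![1, 3]
  let b : Fin 3 → ℤ := ![1, 1, 1]
  have hb : ∀ j, b j = 1 := by decide
  let π : (⨁ fun i => P3.O k (a i)) ⟶ P3.O k (a 0) := biproduct.π (fun i => P3.O k (a i)) 0
  let B : Fin 3 → (P3 k).Modules := fun j => P3.O k (b j) ⊞ P3.O k (-b j - 1)
  -- Minimality: a nonzero component `𝒪(1) ⟶ 𝒪(1)` of `α` would be an isomorphism.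
  have hα : ∀ j, biprod.inl ≫ biproduct.ι B j ≫ M.α ≫ π = 0 := by
    intro j
    by_contra h
    have hiso : IsIso ((biprod.inl ≫ biproduct.ι B j) ≫ M.α ≫ π) := by
      rw [Category.assoc]
      exact isIso_of_ne_zero hne (hb j) _ h
    exact M.not_isMinimal_of_isIso (isLineBundle_twist (fun x =>
      let ⟨i, hi⟩ := exists_X_notMem x
      ⟨X i, MvPolynomial.isHomogeneous_X k i, hi⟩) _) (not_isZero_twist k 0 _)
        (biprod.inl ≫ biproduct.ι B j) π hM
  -- So `α` reaches the summand `𝒪(1)` through the three cubic forms `𝒪(-2) ⟶ 𝒪(1)` only.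
  have hsum : M.α ≫ π = ∑ j, (biproduct.π B j ≫ biprod.snd) ≫
      (biprod.inr ≫ biproduct.ι B j ≫ M.α ≫ π) := by
    have htotal : ∀ j, biproduct.ι B j ≫ M.α ≫ π =
        biprod.snd ≫ biprod.inr ≫ biproduct.ι B j ≫ M.α ≫ π := by
      intro j
      conv_lhs => rw [← Category.id_comp (biproduct.ι B j ≫ M.α ≫ π), ← biprod.total,
        Preadditive.add_comp, Category.assoc, Category.assoc, hα, comp_zero, zero_add]
    calc M.α ≫ π = (∑ j, biproduct.π B j ≫ biproduct.ι B j) ≫ M.α ≫ π := by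
          rw [biproduct.total, Category.id_comp]
      _ = _ := by
          rw [Preadditive.sum_comp]
          refine Finset.sum_congr rfl fun j _ => ?_
          rw [Category.assoc, Category.assoc, ← htotal]
  have hsurj : SheafMonad.IsSurjective (M.α ≫ π) := M.surjective.comp_of_isSplitEpi π
  rw [hsum] at hsurj
  refine not_isSurjective_sum hne (by decide) (d := 3) (by decide) (fun j => ?_) _ _ hsurj
  rw [hb]
  rfl

end
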